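/- Let $G$ be a finite simple graph with $m$ edges that is not a complete graph (in particular $G$ has at least two vertices). Let $\omega(G)$ be the clique number of $G$, that is, the largest number of vertices in a clique of $G$, and let $\lambda_1 \ge \lambda_2 \ge \dots \ge \lambda_n$ be the eigenvalues of the adjacency matrix of $G$, listed with multiplicity. Then \[ \lambda_1^2 + \lambda_2^2 \le \left(1 - \frac{1}{\omega(G) + 50\,\omega(G)^{5/6}}\right) 2m . \] -/

import Mathlib

namespace SimpleGraph

/-- A graph that is not complete has at least two vertices. -/
theorem one_lt_card_of_ne_top {V : Type*} [Fintype V] {G : SimpleGraph V} (hG : G ≠ ⊤) :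
    1 < Fintype.card V := by
  by_contra h
  have : Subsingleton V := Fintype.card_le_one_iff_subsingleton.mp (not_lt.mp h)
  exact hG (Subsingleton.elim G ⊤)

/-- The eigenvalues of the real adjacency matrix of `G`, with multiplicity, in non-increasing
order; the index is zero-based, so that `λ₁` has index `0` and `λ₂` has index `1`. -/
noncomputable def adjEigenvalue {V : Type*} [Fintype V] [DecidableEq V] (G : SimpleGraph V)
    [DecidableRel G.Adj] : Fin (Fintype.card V) → ℝ :=
  (G.isHermitian_adjMatrix ℝ).eigenvalues₀

end SimpleGraph

/-! ### Motzkin–Straus and Gram matrices of planar vectors. -/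

namespace SimpleGraph

open Finset

variable {V : Type*} [Fintype V] (G : SimpleGraph V) [DecidableRel G.Adj]

/-! Let x, y be orthonormal eigenvectors for λ₁, λ₂, which are non-negative because G is not
complete. The matrix B = λ₁xxᵀ + λ₂yyᵀ is a Gram matrix of planar vectors; its squared norm S and
its inner product with the adjacency matrix both equal λ₁² + λ₂². Let N be the squared norm of the
entries of B that mismatch G: those at non-adjacent pairs and the negative ones at edges.
Cauchy–Schwarz over the edges gives S² ≤ 2m(S − N), so it suffices that S ≤ (ω + 50ω^(5/6))N, which
is `sum_sq_gram_le_mul_mismatch`.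

For vectors in one quadrant the entrywise square of B is a sum of non-negative rank-one matrices,
and Motzkin–Straus gives S ≤ ωN. In general, if N ≤ S/ω then obtuse pairs carry little weight. Hence
`exists_sector` finds almost all the weight in a slightly widened quadrant, and `sum_sq_gram_sub_le`
trims this to a true quadrant at relative cost O(h), where h = ω^(-1/6). For small ω the cruder
`sum_sq_gram_le_two_mul` is enough. -/

/-- The sum of `f` over all ordered pairs of non-adjacent vertices, including the pairs `(i, i)`. -/
def nonadjSum (f : V → V → ℝ) : ℝ := ∑ i, ∑ j, if G.Adj i j then 0 else f i j

theorem nonadjSum_mono {f g : V → V → ℝ} (h : ∀ i j, f i j ≤ g i j) :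
    G.nonadjSum f ≤ G.nonadjSum g := by
  refine sum_le_sum fun i _ => sum_le_sum fun j _ => ?_
  split_ifs
  · exact le_rfl
  · exact h i j

theorem nonadjSum_add (f g : V → V → ℝ) :
    G.nonadjSum (fun i j => f i j + g i j) = G.nonadjSum f + G.nonadjSum g := by
  simp only [nonadjSum, ← sum_add_distrib]
  refine sum_congr rfl fun i _ => sum_congr rfl fun j _ => ?_
  split_ifs <;> simp

theorem nonadjSum_const_mul (c : ℝ) (f : V → V → ℝ) :
    G.nonadjSum (fun i j => c * f i j) = c * G.nonadjSum f := by
  simp only [nonadjSum, mul_sum, mul_ite, mul_zero]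

/-- The Motzkin–Straus inequality on a set of vertices without a clique of `n + 1` vertices. -/
theorem sq_sum_le_mul_sum_nonadj {V : Type*} (G : SimpleGraph V) [DecidableRel G.Adj]
    {w : V → ℝ} (hw : ∀ i, 0 ≤ w i) (n : ℕ) :
    ∀ X : Finset V, (∀ K ⊆ X, G.IsClique (K : Set V) → #K ≤ n) →
      (∑ i ∈ X, w i) ^ 2 ≤ n * ∑ i ∈ X, ∑ j ∈ X, if G.Adj i j then 0 else w i * w j := by
  classical
  induction n with
  | zero =>
    intro X hX
    have : X = ∅ := by
      by_contra hne
      obtain ⟨v, hv⟩ := nonempty_iff_ne_empty.mpr hne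
      simpa using hX {v} (by simpa using hv) (by simp)
    simp [this]
  | succ n ih =>
    intro X hX
    rcases X.eq_empty_or_nonempty with rfl | hne
    · simp
    -- `R u` is the weight of the non-neighbours of `u`. For `v` minimizing it, every row from `T`
    -- contributes at least `w u * r`, while the neighbourhood `Y` has smaller clique number.
    set R : V → ℝ := fun u => ∑ k ∈ X, if G.Adj u k then 0 else w k with hR
    obtain ⟨v, hv, hmin⟩ := X.exists_min_image R hne
    set Y := X.filter (G.Adj v) with hY
    set T := X.filter (fun u => ¬ G.Adj v u) with hT
    have hYX : Y ⊆ X := filter_subset _ _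
    have hr : R v = ∑ i ∈ T, w i := by
      rw [hR, hT, sum_filter]
      exact sum_congr rfl fun k _ => by split_ifs <;> rfl
    have hrow : ∀ Z : Finset V, ∀ u,
        (∑ j ∈ Z, if G.Adj u j then 0 else w u * w j) = w u * ∑ j ∈ Z, if G.Adj u j then 0 else w j :=
      fun Z u => by rw [mul_sum]; exact sum_congr rfl fun j _ => by split_ifs <;> simp
    have hYcl : ∀ K ⊆ Y, G.IsClique (K : Set V) → #K ≤ n := by
      intro K hK hKc
      have hvK : v ∉ K := fun h => G.irrefl (mem_filter.mp (hK h)).2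
      have := hX (insert v K) (insert_subset hv (hK.trans hYX)) (by
        rw [coe_insert]
        exact hKc.insert fun b hb _ => (mem_filter.mp (hK hb)).2)
      rw [card_insert_of_notMem hvK] at this
      omega
    have hF := ih Y hYcl
    set FY := ∑ i ∈ Y, ∑ j ∈ Y, if G.Adj i j then 0 else w i * w j with hFY
    set r := ∑ i ∈ T, w i
    set y := ∑ i ∈ Y, w i
    have hr0 : 0 ≤ r := sum_nonneg fun i _ => hw i
    have hy0 : 0 ≤ y := sum_nonneg fun i _ => hw i
    have hsum : ∑ i ∈ X, w i = y + r := (sum_filter_add_sum_filter_not X (G.Adj v) w).symm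
    have hFX : r ^ 2 + FY ≤ ∑ i ∈ X, ∑ j ∈ X, if G.Adj i j then 0 else w i * w j := by
      rw [← sum_filter_add_sum_filter_not X (G.Adj v), add_comm]
      refine add_le_add (sum_le_sum fun u _ => ?_) ?_
      · refine sum_le_sum_of_subset_of_nonneg hYX fun j _ _ => ?_
        split_ifs
        · exact le_rfl
        · exact mul_nonneg (hw _) (hw _)
      · rw [sq]
        calc r * r = ∑ u ∈ T, w u * r := by rw [sum_mul]
          _ ≤ _ := sum_le_sum fun u hu => by
            rw [hrow]
            refine mul_le_mul_of_nonneg_left ?_ (hw u)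
            rw [← hr]
            exact hmin u (mem_filter.mp hu).1
    rw [hsum]
    refine le_trans ?_ (mul_le_mul_of_nonneg_left hFX (by positivity))
    push_cast
    rcases Nat.eq_zero_or_pos n with rfl | hn
    · have : y = 0 := by
        have h2 : y ^ 2 ≤ 0 := by simpa using hF
        exact pow_eq_zero_iff two_ne_zero |>.mp (le_antisymm h2 (sq_nonneg y))
      have hFY0 : 0 ≤ FY := sum_nonneg fun i _ => sum_nonneg fun j _ => by
        split_ifs
        · exact le_rfl
        · exact mul_nonneg (hw _) (hw _)
      simp [this, hFY0]
    · have hn' : (0 : ℝ) < n := by exact_mod_cast hn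
      -- Expand `(n * r - y) ^ 2 ≥ 0` and use `y ^ 2 ≤ n * FY`.
      have h3 : 2 * r * y ≤ n * r ^ 2 + FY := by
        refine le_of_mul_le_mul_left ?_ hn'
        nlinarith [sq_nonneg (n * r - y)]
      nlinarith

/-- The Motzkin–Straus inequality. -/
theorem sq_sum_le_cliqueNum_mul_nonadjSum {w : V → ℝ} (hw : ∀ i, 0 ≤ w i) :
    (∑ i, w i) ^ 2 ≤ G.cliqueNum * G.nonadjSum fun i j => w i * w j :=
  G.sq_sum_le_mul_sum_nonadj hw _ univ fun _ _ hK => IsClique.card_le_cliqueNum (tc := hK)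

theorem sum_sum_sq_mul_add_mul (a b : V → ℝ) :
    ∑ i, ∑ j, (a i * a j + b i * b j) ^ 2 =
      (∑ i, a i ^ 2) ^ 2 + (∑ i, b i ^ 2) ^ 2 + 2 * (∑ i, a i * b i) ^ 2 := by
  have h (f : V → ℝ) : (∑ i, f i) ^ 2 = ∑ i, ∑ j, f i * f j := by rw [sq, sum_mul_sum]
  simp only [h, mul_sum, ← sum_add_distrib]
  exact sum_congr rfl fun i _ => sum_congr rfl fun j _ => by ring

/-- The squared Gram matrix of vectors in a quadrant is completely positive, so that the
Motzkin–Straus inequality holds for it. -/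
theorem sum_sq_gram_le_of_nonneg {a b : V → ℝ} (ha : ∀ i, 0 ≤ a i) (hb : ∀ i, 0 ≤ b i) :
    ∑ i, ∑ j, (a i * a j + b i * b j) ^ 2 ≤
      G.cliqueNum * G.nonadjSum fun i j => (a i * a j + b i * b j) ^ 2 := by
  have e : (fun i j => (a i * a j + b i * b j) ^ 2) = fun i j =>
      (a i ^ 2 * a j ^ 2 + b i ^ 2 * b j ^ 2) + 2 * ((a i * b i) * (a j * b j)) := by
    ext i j; ring
  rw [sum_sum_sq_mul_add_mul, e, nonadjSum_add, nonadjSum_add, nonadjSum_const_mul]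
  have h1 := G.sq_sum_le_cliqueNum_mul_nonadjSum (w := fun i => a i ^ 2) fun i => sq_nonneg _
  have h2 := G.sq_sum_le_cliqueNum_mul_nonadjSum (w := fun i => b i ^ 2) fun i => sq_nonneg _
  have h3 := G.sq_sum_le_cliqueNum_mul_nonadjSum (w := fun i => a i * b i)
    fun i => mul_nonneg (ha i) (hb i)
  linarith

/-- For arbitrary vectors in the plane the inequality holds with a loss of a factor `2`. -/
theorem sum_sq_gram_le_two_mul (a b : V → ℝ) :
    ∑ i, ∑ j, (a i * a j + b i * b j) ^ 2 ≤
      2 * G.cliqueNum * G.nonadjSum fun i j => (a i * a j + b i * b j) ^ 2 := by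
  -- `p` and `q` indicate the two pairs of opposite quadrants. Absolute values fold each pair into
  -- one quadrant without changing squared inner products inside it.
  set p : V → ℝ := fun i => if 0 ≤ a i * b i then 1 else 0 with hp
  set q : V → ℝ := fun i => if 0 ≤ a i * b i then 0 else 1 with hq
  have hp0 : ∀ i, 0 ≤ p i := fun i => by simp only [hp]; split_ifs <;> norm_num
  have hq0 : ∀ i, 0 ≤ q i := fun i => by simp only [hq]; split_ifs <;> norm_num
  have h1 := G.sum_sq_gram_le_of_nonneg (a := fun i => p i * |a i|) (b := fun i => p i * |b i|)
    (fun i => mul_nonneg (hp0 i) (abs_nonneg _)) fun i => mul_nonneg (hp0 i) (abs_nonneg _)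
  have h2 := G.sum_sq_gram_le_of_nonneg (a := fun i => q i * |a i|) (b := fun i => q i * |b i|)
    (fun i => mul_nonneg (hq0 i) (abs_nonneg _)) fun i => mul_nonneg (hq0 i) (abs_nonneg _)
  have key : ∀ s t u v : ℝ, 0 ≤ (s * u) * (t * v) →
      (|s| * |t| + |u| * |v|) ^ 2 = (s * t + u * v) ^ 2 := by
    intro s t u v h
    have : |s| * |t| * (|u| * |v|) = s * t * (u * v) := by
      rw [← abs_mul, ← abs_mul, ← abs_mul, abs_of_nonneg]
      linarith [show s * t * (u * v) = (s * u) * (t * v) by ring]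
    have e1 := sq_abs s; have e2 := sq_abs t; have e3 := sq_abs u; have e4 := sq_abs v
    calc _ = |s| ^ 2 * |t| ^ 2 + |u| ^ 2 * |v| ^ 2 + 2 * (|s| * |t| * (|u| * |v|)) := by ring
      _ = _ := by rw [e1, e2, e3, e4, this]; ring
  have h3 : G.nonadjSum (fun i j => (p i * |a i| * (p j * |a j|) + p i * |b i| * (p j * |b j|)) ^ 2
      + (q i * |a i| * (q j * |a j|) + q i * |b i| * (q j * |b j|)) ^ 2) ≤
      G.nonadjSum fun i j => (a i * a j + b i * b j) ^ 2 := by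
    refine G.nonadjSum_mono fun i j => ?_
    simp only [hp, hq]
    split_ifs with hi hj hj
    · simpa using (key _ _ _ _ (mul_nonneg hi hj)).le
    · simpa using sq_nonneg _
    · simpa using sq_nonneg _
    · simpa using (key _ _ _ _ (mul_nonneg_of_nonpos_of_nonpos (not_le.mp hi).le
        (not_le.mp hj).le)).le
  rw [nonadjSum_add] at h3
  have h4 : ∑ i, ∑ j, (a i * a j + b i * b j) ^ 2 ≤
      2 * (∑ i, ∑ j, (p i * |a i| * (p j * |a j|) + p i * |b i| * (p j * |b j|)) ^ 2 +
        ∑ i, ∑ j, (q i * |a i| * (q j * |a j|) + q i * |b i| * (q j * |b j|)) ^ 2) := by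
    rw [sum_sum_sq_mul_add_mul, sum_sum_sq_mul_add_mul (fun i => p i * |a i|),
      sum_sum_sq_mul_add_mul (fun i => q i * |a i|)]
    have ea : ∑ i, a i ^ 2 = ∑ i, (p i * |a i|) ^ 2 + ∑ i, (q i * |a i|) ^ 2 := by
      rw [← sum_add_distrib]
      exact sum_congr rfl fun i _ => by simp only [hp, hq]; split_ifs <;> simp
    have eb : ∑ i, b i ^ 2 = ∑ i, (p i * |b i|) ^ 2 + ∑ i, (q i * |b i|) ^ 2 := by
      rw [← sum_add_distrib]
      exact sum_congr rfl fun i _ => by simp only [hp, hq]; split_ifs <;> simp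
    have eab : ∑ i, a i * b i =
        ∑ i, p i * |a i| * (p i * |b i|) - ∑ i, q i * |a i| * (q i * |b i|) := by
      rw [← sum_sub_distrib]
      refine sum_congr rfl fun i _ => ?_
      simp only [hp, hq]
      split_ifs with hi
      · simp [← abs_mul, abs_of_nonneg hi]
      · simp [← abs_mul, abs_of_neg (not_le.mp hi)]
    rw [ea, eb, eab]
    have h : ∀ x y : ℝ, (x + y) ^ 2 ≤ 2 * (x ^ 2 + y ^ 2) := fun x y => by
      nlinarith [sq_nonneg (x - y)]
    have h' : ∀ x y : ℝ, (x - y) ^ 2 ≤ 2 * (x ^ 2 + y ^ 2) := fun x y => by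
      nlinarith [sq_nonneg (x + y)]
    linarith [h (∑ i, (p i * |a i|) ^ 2) (∑ i, (q i * |a i|) ^ 2),
      h (∑ i, (p i * |b i|) ^ 2) (∑ i, (q i * |b i|) ^ 2),
      h' (∑ i, p i * |a i| * (p i * |b i|)) (∑ i, q i * |a i| * (q i * |b i|))]
  have h5 := mul_le_mul_of_nonneg_left h3 (Nat.cast_nonneg (α := ℝ) G.cliqueNum)
  linarith

end SimpleGraph

/-! ### Concentration in a sector slightly wider than a quadrant. -/

namespace SimpleGraph

open Finset Real

/-- Trimming unit vectors of a widened quadrant to a true one. Lowering `s` by `2 * h` pays for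
cutting off a negative `c ≥ -h`, so squared inner products do not grow. The inner product drops by
at most `4 * h + h`, its square by at most `10 * h`. -/
theorem max_mul_add_max_mul_bounds {h c s c' s' : ℝ} (h0 : 0 ≤ h) (h1 : h ≤ 1 / 50)
    (hcs : c ^ 2 + s ^ 2 = 1) (hcs' : c' ^ 2 + s' ^ 2 = 1) (hs : 0 ≤ s) (hs' : 0 ≤ s')
    (hc : -h ≤ c) (hc' : -h ≤ c') :
    (max c 0 * max c' 0 + max (s - 2 * h) 0 * max (s' - 2 * h) 0) ^ 2 ≤ (c * c' + s * s') ^ 2 ∧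
      (c * c' + s * s') ^ 2 - 10 * h ≤
        (max c 0 * max c' 0 + max (s - 2 * h) 0 * max (s' - 2 * h) 0) ^ 2 := by
  have hss1 : s ≤ 1 := by nlinarith [sq_nonneg c]
  have hss1' : s' ≤ 1 := by nlinarith [sq_nonneg c']
  have hcc1 : c ≤ 1 := by nlinarith [sq_nonneg s]
  have hcc1' : c' ≤ 1 := by nlinarith [sq_nonneg s']
  obtain ⟨g, hg⟩ : ∃ g, g = max c 0 * max c' 0 + max (s - 2 * h) 0 * max (s' - 2 * h) 0 := ⟨_, rfl⟩
  obtain ⟨d, hd⟩ : ∃ d, d = c * c' + s * s' := ⟨_, rfl⟩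
  rw [← hg, ← hd]
  have hS0 : 0 ≤ max (s - 2 * h) 0 * max (s' - 2 * h) 0 :=
    mul_nonneg (le_max_right _ _) (le_max_right _ _)
  have hS1 : max (s - 2 * h) 0 * max (s' - 2 * h) 0 ≤ s * s' :=
    mul_le_mul (max_le (by linarith) hs) (max_le (by linarith) hs') (le_max_right _ _) hs
  have hS2 : s * s' - 4 * h ≤ max (s - 2 * h) 0 * max (s' - 2 * h) 0 := by
    rcases le_total (s - 2 * h) 0 with h2 | h2
    · rw [max_eq_right h2]; nlinarith
    rcases le_total (s' - 2 * h) 0 with h3 | h3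
    · rw [max_eq_right h3]; nlinarith
    rw [max_eq_left h2, max_eq_left h3]; nlinarith
  have mixed : ∀ c s c' s' : ℝ, c ^ 2 + s ^ 2 = 1 → 0 ≤ s → 0 ≤ s' → -h ≤ c → c' ≤ 1 → c ≤ 0 →
      0 ≤ c' → max (s - 2 * h) 0 * max (s' - 2 * h) 0 = 0 ∨
        max (s - 2 * h) 0 * max (s' - 2 * h) 0 ≤ c * c' + s * s' := by
    intro c s c' s' e hs hs' hc hc1' hcn hcp
    rcases le_total (s' - 2 * h) 0 with h3 | h3
    · left; rw [max_eq_right h3, mul_zero]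
    right
    have hs9 : 1 / 2 ≤ s := by nlinarith
    rw [max_eq_left h3, max_eq_left (by linarith)]
    nlinarith
  have hupper : g = 0 ∨ g ≤ d := by
    rcases le_total 0 c with hc0 | hc0 <;> rcases le_total 0 c' with hc0' | hc0'
    · right; rw [hg, hd, max_eq_left hc0, max_eq_left hc0']; linarith
    · rcases mixed c' s' c s hcs' hs' hs hc' hcc1 hc0' hc0 with h2 | h2
      · left; rw [hg, max_eq_right hc0', mul_comm (max (s - _) 0), h2]; ring
      · right; rw [hg, hd, max_eq_right hc0', mul_comm (max (s - _) 0)]; linarith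
    · rcases mixed c s c' s' hcs hs hs' hc hcc1' hc0 hc0' with h2 | h2
      · left; rw [hg, max_eq_right hc0, h2]; ring
      · right; rw [hg, hd, max_eq_right hc0]; linarith
    · right; rw [hg, hd, max_eq_right hc0]
      linarith [mul_nonneg_of_nonpos_of_nonpos hc0 hc0']
  have hg0 : 0 ≤ g := hg ▸ add_nonneg (mul_nonneg (le_max_right _ _) (le_max_right _ _)) hS0
  have hlower : d - 5 * h ≤ g := by
    have : c * c' - h ≤ max c 0 * max c' 0 := by
      rcases le_total 0 c with hc0 | hc0 <;> rcases le_total 0 c' with hc0' | hc0'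
      · rw [max_eq_left hc0, max_eq_left hc0']; linarith
      · rw [max_eq_right hc0']; nlinarith
      · rw [max_eq_right hc0]; nlinarith
      · rw [max_eq_right hc0]; nlinarith
    linarith
  have hd1 : d ≤ 1 := by linarith [sq_nonneg (c - c'), sq_nonneg (s - s')]
  have hdh : -h ≤ d := by
    have hcc : -h ≤ c * c' := by
      rcases le_total 0 c with hc0 | hc0 <;> rcases le_total 0 c' with hc0' | hc0'
      · linarith [mul_nonneg hc0 hc0']
      · linarith [mul_nonneg hc0 (by linarith : 0 ≤ c' + h), mul_nonneg h0 (sub_nonneg.mpr hcc1)]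
      · linarith [mul_nonneg hc0' (by linarith : 0 ≤ c + h), mul_nonneg h0 (sub_nonneg.mpr hcc1')]
      · linarith [mul_nonneg_of_nonpos_of_nonpos hc0 hc0']
    linarith [mul_nonneg hs hs']
  constructor
  · rcases hupper with h2 | h2
    · rw [h2]; simpa using sq_nonneg d
    · exact pow_le_pow_left₀ hg0 h2 2
  · rcases le_total d (5 * h) with h2 | h2
    · have h3 : d ^ 2 ≤ (5 * h) ^ 2 := sq_le_sq' (by linarith) h2
      have h4 : h * h ≤ h * (1 / 50) := mul_le_mul_of_nonneg_left h1 h0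
      linarith [sq_nonneg g, show (5 * h) ^ 2 = 25 * (h * h) by ring]
    · have : (d - 5 * h) ^ 2 ≤ g ^ 2 := pow_le_pow_left₀ (by linarith) hlower 2
      have h3 : h * d ≤ h * 1 := mul_le_mul_of_nonneg_left hd1 h0
      linarith [mul_nonneg h0 h0, show (d - 5 * h) ^ 2 = d ^ 2 - 10 * (h * d) + 25 * (h * h) by ring]

/-- A quantile of a finite weighted family of reals. -/
theorem exists_quantile {ι : Type*} (X : Finset ι) (f p : ι → ℝ) {t : ℝ} (ht : 0 < t)
    (hp : ∀ i, 0 ≤ p i) (hX : t ≤ ∑ i ∈ X, p i) :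
    ∃ α, ∑ i ∈ X with f i < α, p i ≤ t ∧ t ≤ ∑ i ∈ X with f i ≤ α, p i := by
  classical
  have key : ∀ Z ⊆ X, t ≤ ∑ i ∈ Z, p i → ∃ k ∈ Z, t ≤ ∑ i ∈ X with f i ≤ f k, p i := by
    intro Z hZX hZ
    have hne : Z.Nonempty := by
      by_contra h
      rw [not_nonempty_iff_eq_empty.mp h, sum_empty] at hZ
      linarith
    obtain ⟨k, hk, hmax⟩ := Z.exists_max_image f hne
    refine ⟨k, hk, hZ.trans (sum_le_sum_of_subset_of_nonneg (fun i hi => ?_) fun i _ _ => hp i)⟩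
    exact mem_filter.mpr ⟨hZX hi, hmax i hi⟩
  obtain ⟨k, hk, hkt⟩ := key X subset_rfl hX
  obtain ⟨m, hm, hmin⟩ := exists_min_image {k ∈ X | t ≤ ∑ i ∈ X with f i ≤ f k, p i} f
    ⟨k, mem_filter.mpr ⟨hk, hkt⟩⟩
  refine ⟨f m, ?_, (mem_filter.mp hm).2⟩
  by_contra! hlt
  obtain ⟨l, hl, hlt'⟩ := key _ (filter_subset _ X) hlt.le
  have := hmin l (mem_filter.mpr ⟨(mem_filter.mp hl).1, hlt'⟩)
  exact absurd (mem_filter.mp hl).2 (not_lt.mpr this)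

variable {V : Type*} [Fintype V]

/-- If pairs of vectors in the plane at an obtuse angle carry little weight, then almost all the
weight lies in a sector slightly wider than a quadrant. -/
theorem exists_sector [DecidableEq V] {r θ : V → ℝ} {h : ℝ} (h0 : 0 < h) (h1 : h ≤ 1 / 50)
    (hP : 0 < ∑ i, r i ^ 2)
    (hO : ∑ i, ∑ j, (if cos (θ i - θ j) < 0 then r i ^ 2 * (r j ^ 2 * cos (θ i - θ j) ^ 2) else 0)
      ≤ h ^ 6 * (∑ i, r i ^ 2) ^ 2) :
    ∃ (Q : Finset V) (ψ : V → ℝ), (∀ i j, cos (ψ i - ψ j) = cos (θ i - θ j)) ∧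
      (∀ i ∈ Q, 0 ≤ sin (ψ i) ∧ -h ≤ cos (ψ i)) ∧
      ∑ i with i ∉ Q, r i ^ 2 ≤ 1.01 * h * ∑ i, r i ^ 2 := by
  set P := ∑ i, r i ^ 2 with hPdef
  set X : V → ℝ := fun k => ∑ j, if cos (θ k - θ j) < 0 then r j ^ 2 * cos (θ k - θ j) ^ 2 else 0
    with hXdef
  -- By averaging, some `k` has at most the mean obtuse weight; angles are then measured from `k`.
  obtain ⟨k, hk⟩ : ∃ k, X k ≤ h ^ 6 * P := by
    by_contra! hcon
    obtain ⟨l, -, hl⟩ : ∃ l ∈ univ, 0 < r l ^ 2 := exists_lt_of_sum_lt (by simpa using hP)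
    have : ∑ i, r i ^ 2 * (h ^ 6 * P) < ∑ i, r i ^ 2 * X i :=
      sum_lt_sum (fun i _ => mul_le_mul_of_nonneg_left (hcon i).le (sq_nonneg _))
        ⟨l, mem_univ l, mul_lt_mul_of_pos_left (hcon l) hl⟩
    have e : ∑ i, r i ^ 2 * X i = ∑ i, ∑ j,
        (if cos (θ i - θ j) < 0 then r i ^ 2 * (r j ^ 2 * cos (θ i - θ j) ^ 2) else 0) :=
      sum_congr rfl fun i _ => by
        rw [hXdef, mul_sum]
        exact sum_congr rfl fun j _ => by split_ifs <;> simp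
    rw [← sum_mul, ← hPdef, e] at this
    nlinarith
  set φ : V → ℝ := fun i => toIocMod two_pi_pos (-π) (θ i - θ k) with hφ
  have hφmem : ∀ i, -π < φ i ∧ φ i ≤ π := fun i => by
    have := toIocMod_mem_Ioc two_pi_pos (-π) (θ i - θ k)
    exact ⟨this.1, by have := this.2; simp only [hφ]; linarith⟩
  have hφeq : ∀ i, ∃ n : ℤ, φ i = θ i - θ k - n * (2 * π) := fun i =>
    ⟨toIocDiv two_pi_pos (-π) (θ i - θ k), by
      simp only [hφ, ← self_sub_toIocDiv_zsmul, zsmul_eq_mul]⟩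
  have hφcos : ∀ i j, cos (φ i - φ j) = cos (θ i - θ j) := fun i j => by
    obtain ⟨n, hn⟩ := hφeq i
    obtain ⟨m, hm⟩ := hφeq j
    rw [hn, hm, ← Real.cos_add_int_mul_two_pi (θ i - θ j) (m - n)]
    congr 1; push_cast; ring
  have hφcosk : ∀ i, cos (φ i) = cos (θ k - θ i) := fun i => by
    obtain ⟨n, hn⟩ := hφeq i
    rw [hn, Real.cos_sub_int_mul_two_pi, ← Real.cos_neg]
    congr 1; ring
  set δ := arcsin h with hδ
  have hsinδ : sin δ = h := sin_arcsin (by linarith) (by linarith)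
  have hδ0 : 0 ≤ δ := arcsin_nonneg.mpr h0.le
  have hδ6 : δ ≤ π / 6 := by
    rw [hδ, arcsin_le_iff_le_sin ⟨by linarith, by linarith⟩
      ⟨by linarith [pi_pos], by linarith [pi_pos]⟩, sin_pi_div_six]
    linarith
  have hcosδ : cos (π / 2 + δ) = -h := by rw [add_comm, cos_add_pi_div_two, hsinδ]
  have hπ := pi_pos
  set V₁ : Finset V := {i | -h ≤ cos (φ i)} with hV₁
  have hV₁φ : ∀ i ∈ V₁, |φ i| ≤ π / 2 + δ := fun i hi => by
    by_contra! hlt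
    have h2 := cos_lt_cos_of_nonneg_of_le_pi (by linarith)
      (abs_le.mpr ⟨(hφmem i).1.le, (hφmem i).2⟩) hlt
    rw [cos_abs, hcosδ] at h2
    linarith [(mem_filter.mp hi).2]
  have hm₁ : ∑ i with i ∉ V₁, r i ^ 2 ≤ h ^ 4 * P := by
    have h2 : h ^ 2 * ∑ i with i ∉ V₁, r i ^ 2 ≤ X k := by
      rw [mul_sum, sum_filter]
      refine sum_le_sum fun j _ => ?_
      by_cases hj : j ∈ V₁
      · rw [if_neg (not_not.mpr hj)]
        split_ifs <;> positivity
      · have : cos (θ k - θ j) < -h := by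
          rw [← hφcosk]; simpa [hV₁] using hj
        rw [if_pos hj, if_pos (by linarith), mul_comm]
        exact mul_le_mul_of_nonneg_left (by nlinarith) (sq_nonneg _)
    refine le_of_mul_le_mul_left (?_ : h ^ 2 * _ ≤ h ^ 2 * _) (by positivity)
    calc _ ≤ X k := h2
      _ ≤ _ := hk
      _ = _ := by ring
  have hsplit : ∑ i ∈ V₁, r i ^ 2 + ∑ i with i ∉ V₁, r i ^ 2 = P := by
    rw [hPdef, ← sum_filter_add_sum_filter_not univ (fun i => i ∈ V₁)]
    simp
  have hh2 : h ^ 2 ≤ 1 / 2500 := by nlinarith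
  have hh3 : h ^ 3 ≤ h / 2500 := by nlinarith
  have hh4 : h ^ 4 ≤ h / 2500 := by nlinarith [mul_nonneg h0.le (pow_nonneg h0.le 2)]
  -- The sector starts at the `h`-quantile `α`: little weight lies below it, yet enough lies at or
  -- below it to make weight in `T`, at cosine at most `-h` from it, expensive.
  obtain ⟨α, hα₁, hα₂⟩ := exists_quantile V₁ φ (fun i => r i ^ 2) (t := h * P) (by positivity)
    (fun i => sq_nonneg _) (by nlinarith)
  set T : Finset V := {i ∈ V₁ | α + (π / 2 + δ) < φ i} with hT
  have hmT : ∑ i ∈ T, r i ^ 2 ≤ h ^ 3 * P := by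
    have hobt : ∀ i ∈ {i ∈ V₁ | φ i ≤ α}, ∀ j ∈ T, cos (θ i - θ j) ≤ -h := by
      intro i hi j hj
      have hi' := abs_le.mp (hV₁φ i (mem_filter.mp hi).1)
      have hj' := abs_le.mp (hV₁φ j (mem_filter.mp hj).1)
      have hi2 := (mem_filter.mp hi).2
      have hj2 := (mem_filter.mp hj).2
      rw [← hφcos, ← cos_neg, neg_sub, ← hcosδ]
      -- The difference may exceed `π`, but is at most `π + 2 * δ`; since `δ ≤ π / 6`, the
      -- complementary angle is still at least `π / 2 + δ`.
      rcases le_total (φ j - φ i) π with h3 | h3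
      · exact cos_le_cos_of_nonneg_of_le_pi (by linarith) h3 (by linarith)
      · rw [← cos_two_pi_sub (φ j - φ i)]
        exact cos_le_cos_of_nonneg_of_le_pi (by linarith) (by linarith) (by linarith)
    have h2 : h ^ 2 * ((∑ i ∈ V₁ with φ i ≤ α, r i ^ 2) * ∑ j ∈ T, r j ^ 2) ≤ h ^ 6 * P ^ 2 := by
      refine le_trans ?_ hO
      have hnn : ∀ i j, 0 ≤ (if cos (θ i - θ j) < 0 then
          r i ^ 2 * (r j ^ 2 * cos (θ i - θ j) ^ 2) else 0) := fun i j => by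
        split_ifs <;> positivity
      calc _ = ∑ i ∈ V₁ with φ i ≤ α, ∑ j ∈ T, h ^ 2 * (r i ^ 2 * r j ^ 2) := by
            rw [sum_mul_sum]; simp only [mul_sum]
        _ ≤ ∑ i ∈ V₁ with φ i ≤ α, ∑ j ∈ T, (if cos (θ i - θ j) < 0 then
              r i ^ 2 * (r j ^ 2 * cos (θ i - θ j) ^ 2) else 0) := by
            refine sum_le_sum fun i hi => sum_le_sum fun j hj => ?_
            have h3 := hobt i hi j hj
            rw [if_pos (by linarith)]
            have h4 : h ^ 2 ≤ cos (θ i - θ j) ^ 2 := by nlinarith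
            calc h ^ 2 * (r i ^ 2 * r j ^ 2) = r i ^ 2 * (r j ^ 2 * h ^ 2) := by ring
              _ ≤ _ := by gcongr
        _ ≤ ∑ i ∈ V₁ with φ i ≤ α, ∑ j, (if cos (θ i - θ j) < 0 then
              r i ^ 2 * (r j ^ 2 * cos (θ i - θ j) ^ 2) else 0) :=
            sum_le_sum fun i _ => sum_le_sum_of_subset_of_nonneg (subset_univ _)
              fun j _ _ => hnn i j
        _ ≤ _ := sum_le_sum_of_subset_of_nonneg (subset_univ _)
              fun i _ _ => sum_nonneg fun j _ => hnn i j
    have hT0 : 0 ≤ ∑ j ∈ T, r j ^ 2 := sum_nonneg fun _ _ => sq_nonneg _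
    refine le_of_mul_le_mul_left (?_ : h ^ 3 * P * _ ≤ h ^ 3 * P * _) (by positivity)
    calc h ^ 3 * P * ∑ i ∈ T, r i ^ 2 = h ^ 2 * (h * P * ∑ j ∈ T, r j ^ 2) := by ring
      _ ≤ h ^ 2 * ((∑ i ∈ V₁ with φ i ≤ α, r i ^ 2) * ∑ j ∈ T, r j ^ 2) := by gcongr
      _ ≤ _ := h2
      _ = _ := by ring
  refine ⟨{i ∈ V₁ | α ≤ φ i ∧ φ i ≤ α + (π / 2 + δ)}, fun i => φ i - α, fun i j => ?_,
    fun i hi => ?_, ?_⟩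
  · rw [sub_sub_sub_cancel_right, hφcos]
  · obtain ⟨-, h2, h3⟩ := mem_filter.mp hi
    refine ⟨sin_nonneg_of_nonneg_of_le_pi (by linarith) (by linarith), ?_⟩
    rw [← hcosδ]
    exact cos_le_cos_of_nonneg_of_le_pi (by linarith) (by linarith) (by linarith)
  -- The discarded weight is at most `h ^ 4 + h + h ^ 3` times `P`.
  · have hsub : ({i | i ∉ ({i ∈ V₁ | α ≤ φ i ∧ φ i ≤ α + (π / 2 + δ)} : Finset V)} : Finset V) ⊆
        (({i | i ∉ V₁} : Finset V) ∪ {i ∈ V₁ | φ i < α}) ∪ T := by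
      intro i hi
      simp only [mem_filter, mem_univ, true_and, mem_union, hT] at hi ⊢
      by_contra! hcon
      exact hi ⟨hcon.1.1, hcon.1.2 hcon.1.1, hcon.2 hcon.1.1⟩
    have hle : ∀ s t : Finset V, ∑ i ∈ s ∪ t, r i ^ 2 ≤ ∑ i ∈ s, r i ^ 2 + ∑ i ∈ t, r i ^ 2 :=
      fun s t => by
        rw [← sum_union_inter]
        exact le_add_of_nonneg_right (sum_nonneg fun _ _ => sq_nonneg _)
    have h2 := (sum_le_sum_of_subset_of_nonneg hsub fun i _ _ => sq_nonneg (r i)).trans (hle _ _)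
    have h3 := hle ({i | i ∉ V₁} : Finset V) {i ∈ V₁ | φ i < α}
    have h4 := mul_le_mul_of_nonneg_right hh3 hP.le
    have h5 := mul_le_mul_of_nonneg_right hh4 hP.le
    have h6 := mul_pos h0 hP
    linarith

end SimpleGraph

/-! ### The mismatch bound. -/

namespace SimpleGraph

open Finset Real

variable {V : Type*} [Fintype V] (G : SimpleGraph V) [DecidableRel G.Adj]

/-- If obtuse pairs carry little weight, the Motzkin–Straus inequality for the squared Gram matrix
holds up to a small additive error. -/
theorem sum_sq_gram_sub_le {r θ : V → ℝ} {h : ℝ} (h0 : 0 < h) (h1 : h ≤ 1 / 50)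
    (hO : ∑ i, ∑ j, (if cos (θ i - θ j) < 0 then r i ^ 2 * (r j ^ 2 * cos (θ i - θ j) ^ 2) else 0)
      ≤ h ^ 6 * (∑ i, r i ^ 2) ^ 2) :
    ∑ i, ∑ j, (r i * r j * cos (θ i - θ j)) ^ 2 - 12.5 * h * (∑ i, r i ^ 2) ^ 2 ≤
      G.cliqueNum * G.nonadjSum fun i j => (r i * r j * cos (θ i - θ j)) ^ 2 := by
  classical
  rcases (sum_nonneg fun i _ => sq_nonneg (r i) : 0 ≤ ∑ i, r i ^ 2).eq_or_lt with hP | hP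
  · have hr : ∀ i, r i = 0 := fun i => by
      have := (sum_eq_zero_iff_of_nonneg fun i _ => sq_nonneg (r i)).mp hP.symm i (mem_univ i)
      exact pow_eq_zero_iff two_ne_zero |>.mp this
    simp [hr, nonadjSum]
  obtain ⟨Q, ψ, hψ, hQ, hm⟩ := exists_sector h0 h1 hP hO
  set P := ∑ i, r i ^ 2 with hPdef
  set f : V → ℝ := fun i => if i ∉ Q then r i ^ 2 else 0 with hf
  have hfsum : ∑ i, f i ≤ 1.01 * h * P := by rwa [sum_filter] at hm
  set a : V → ℝ := fun i => if i ∈ Q then |r i| * max (cos (ψ i)) 0 else 0 with ha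
  set b : V → ℝ := fun i => if i ∈ Q then |r i| * max (sin (ψ i) - 2 * h) 0 else 0 with hb
  have ha0 : ∀ i, 0 ≤ a i := fun i => by
    simp only [ha]; split_ifs <;> positivity
  have hb0 : ∀ i, 0 ≤ b i := fun i => by
    simp only [hb]; split_ifs <;> positivity
  have hB : ∀ i j, (r i * r j * cos (θ i - θ j)) ^ 2 ≤ r i ^ 2 * r j ^ 2 := fun i j => by
    rw [mul_pow, mul_pow]
    exact mul_le_of_le_one_right (by positivity) (cos_sq_le_one _)
  have hpt : ∀ i j, (a i * a j + b i * b j) ^ 2 ≤ (r i * r j * cos (θ i - θ j)) ^ 2 ∧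
      (r i * r j * cos (θ i - θ j)) ^ 2 - (10 * h * (r i ^ 2 * r j ^ 2) +
        (f i * r j ^ 2 + r i ^ 2 * f j)) ≤ (a i * a j + b i * b j) ^ 2 := by
    intro i j
    by_cases hi : i ∈ Q
    · by_cases hj : j ∈ Q
      · obtain ⟨h2, h3⟩ := max_mul_add_max_mul_bounds h0.le h1 (cos_sq_add_sin_sq (ψ i))
          (cos_sq_add_sin_sq (ψ j)) (hQ i hi).1 (hQ j hj).1 (hQ i hi).2 (hQ j hj).2
        rw [← cos_sub, hψ] at h2 h3
        have hp : 0 ≤ r i ^ 2 * r j ^ 2 := by positivity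
        have e : (a i * a j + b i * b j) ^ 2 = r i ^ 2 * r j ^ 2 *
            (max (cos (ψ i)) 0 * max (cos (ψ j)) 0 +
              max (sin (ψ i) - 2 * h) 0 * max (sin (ψ j) - 2 * h) 0) ^ 2 := by
          simp only [ha, hb, if_pos hi, if_pos hj]
          rw [← sq_abs (r i), ← sq_abs (r j)]
          ring
        have hfi : f i = 0 := if_neg (not_not.mpr hi)
        have hfj : f j = 0 := if_neg (not_not.mpr hj)
        rw [e, hfi, hfj, mul_pow, mul_pow]
        exact ⟨mul_le_mul_of_nonneg_left h2 hp, by linarith [mul_le_mul_of_nonneg_left h3 hp]⟩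
      · have hfj : f j = r j ^ 2 := if_pos hj
        have hfi : 0 ≤ f i := by simp only [hf, if_neg (not_not.mpr hi), le_refl]
        have e : (a i * a j + b i * b j) ^ 2 = 0 := by simp [ha, hb, hj]
        rw [e, hfj]
        refine ⟨sq_nonneg _, ?_⟩
        have : 0 ≤ 10 * h * (r i ^ 2 * r j ^ 2) := by positivity
        linarith [hB i j, mul_nonneg hfi (sq_nonneg (r j))]
    · have hfi : f i = r i ^ 2 := if_pos hi
      have hfj : 0 ≤ f j := by simp only [hf]; split_ifs <;> positivity
      have e : (a i * a j + b i * b j) ^ 2 = 0 := by simp [ha, hb, hi]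
      rw [e, hfi]
      refine ⟨sq_nonneg _, ?_⟩
      have : 0 ≤ 10 * h * (r i ^ 2 * r j ^ 2) := by positivity
      linarith [hB i j, mul_nonneg (sq_nonneg (r i)) hfj]
  have hlow : ∑ i, ∑ j, (r i * r j * cos (θ i - θ j)) ^ 2 -
      (10 * h * (P * P) + ((∑ i, f i) * P + P * ∑ i, f i)) ≤
        ∑ i, ∑ j, (a i * a j + b i * b j) ^ 2 := by
    rw [hPdef, sum_mul_sum, sum_mul_sum, sum_mul_sum]
    simp only [mul_sum, ← sum_add_distrib, ← sum_sub_distrib]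
    exact sum_le_sum fun i _ => sum_le_sum fun j _ => (hpt i j).2
  -- Trimming costs `10 * h` and the vertices outside `Q` cost `2 * 1.01 * h`, together below `12.5
  -- * h`.
  have hfP := mul_le_mul_of_nonneg_right hfsum hP.le
  have hhP : 0 ≤ h * P ^ 2 := by positivity
  calc _ ≤ ∑ i, ∑ j, (a i * a j + b i * b j) ^ 2 := by linarith
    _ ≤ _ := G.sum_sq_gram_le_of_nonneg ha0 hb0
    _ ≤ _ := mul_le_mul_of_nonneg_left (G.nonadjSum_mono fun i j => (hpt i j).1) (Nat.cast_nonneg _)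

theorem one_le_cliqueNum {V : Type*} [Finite V] [Nonempty V] (G : SimpleGraph V) : 1 ≤ G.cliqueNum := by
  obtain ⟨v⟩ := ‹Nonempty V›
  simpa using IsClique.card_le_cliqueNum (G := G) (t := {v}) (tc := by simp)

/-- The lower bound for the part of a Gram matrix in the plane that does not match the adjacency
matrix of `G`: all entries at non-adjacent pairs, and the negative entries at edges. -/
theorem sum_sq_gram_le_mul_mismatch [Nonempty V] (a b : V → ℝ) :
    ∑ i, ∑ j, (a i * a j + b i * b j) ^ 2 ≤
      ((G.cliqueNum : ℝ) + 50 * (G.cliqueNum : ℝ) ^ ((5 : ℝ) / 6)) *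
        ∑ i, ∑ j, if G.Adj i j then min (a i * a j + b i * b j) 0 ^ 2
          else (a i * a j + b i * b j) ^ 2 := by
  set S := ∑ i, ∑ j, (a i * a j + b i * b j) ^ 2 with hS
  set N := ∑ i, ∑ j, if G.Adj i j then min (a i * a j + b i * b j) 0 ^ 2
    else (a i * a j + b i * b j) ^ 2 with hN
  have hω : (1 : ℝ) ≤ G.cliqueNum := by exact_mod_cast G.one_le_cliqueNum
  set ω : ℝ := (G.cliqueNum : ℝ) with hωdef
  have hω0 : 0 < ω := by linarith
  have hNn : G.nonadjSum (fun i j => (a i * a j + b i * b j) ^ 2) ≤ N :=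
    sum_le_sum fun i _ => sum_le_sum fun j _ => by
      split_ifs
      · positivity
      · exact le_rfl
  have hNneg : ∑ i, ∑ j, min (a i * a j + b i * b j) 0 ^ 2 ≤ N :=
    sum_le_sum fun i _ => sum_le_sum fun j _ => by
      split_ifs
      · exact le_rfl
      · rcases le_total (a i * a j + b i * b j) 0 with h | h
        · rw [min_eq_left h]
        · rw [min_eq_right h, zero_pow two_ne_zero]; exact sq_nonneg _
  have hN0 : 0 ≤ N := sum_nonneg fun i _ => sum_nonneg fun j _ => by split_ifs <;> positivity
  have hS0 : 0 ≤ S := sum_nonneg fun i _ => sum_nonneg fun j _ => sq_nonneg _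
  -- With this `h`, `ω * N ≤ S` becomes the bound `h ^ 6 * P ^ 2` on obtuse weight, and `ω * h` is
  -- the error term of the theorem.
  set h : ℝ := ω ^ (-(1 : ℝ) / 6) with hh
  have h0 : 0 < h := rpow_pos_of_pos hω0 _
  have hh6 : ω * h ^ 6 = 1 := by
    rw [hh, ← rpow_natCast, ← rpow_mul hω0.le]
    norm_num
    rw [rpow_neg_one, mul_inv_cancel₀ hω0.ne']
  have hω56 : ω ^ ((5 : ℝ) / 6) = ω * h := by
    rw [hh, ← rpow_one_add' hω0.le (by norm_num)]
    norm_num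
  rw [hω56]
  rcases le_total (1 / 50) h with h50 | h50
  · have h2 := G.sum_sq_gram_le_two_mul a b
    calc S ≤ 2 * ω * G.nonadjSum (fun i j => (a i * a j + b i * b j) ^ 2) := h2
      _ ≤ 2 * ω * N := by gcongr
      _ ≤ _ := by
        refine mul_le_mul_of_nonneg_right ?_ hN0
        linarith [mul_le_mul_of_nonneg_left h50 hω0.le]
  by_contra! hcon
  set z : V → ℂ := fun i => ⟨a i, b i⟩ with hz
  set r : V → ℝ := fun i => ‖z i‖ with hr
  set θ : V → ℝ := fun i => (z i).arg with hθ
  have hra : ∀ i, r i * cos (θ i) = a i := fun i => Complex.norm_mul_cos_arg (z i)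
  have hrb : ∀ i, r i * sin (θ i) = b i := fun i => Complex.norm_mul_sin_arg (z i)
  have hB : ∀ i j, r i * r j * cos (θ i - θ j) = a i * a j + b i * b j := fun i j => by
    rw [cos_sub, ← hra i, ← hra j, ← hrb i, ← hrb j]; ring
  have hrsq : ∀ i, r i ^ 2 = a i ^ 2 + b i ^ 2 := fun i => by
    rw [← hra, ← hrb, mul_pow, mul_pow, ← mul_add, cos_sq_add_sin_sq, mul_one]
  set P := ∑ i, r i ^ 2 with hP
  have hPab : P = ∑ i, a i ^ 2 + ∑ i, b i ^ 2 := by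
    rw [hP, ← sum_add_distrib]; exact sum_congr rfl fun i _ => hrsq i
  -- Rank at most two: the squared trace is at most twice the squared norm.
  have hPS : P ^ 2 ≤ 2 * S := by
    rw [hS, sum_sum_sq_mul_add_mul, hPab]
    nlinarith [sq_nonneg (∑ i, a i ^ 2 - ∑ i, b i ^ 2), sq_nonneg (∑ i, a i * b i)]
  have hSP : S ≤ P ^ 2 := by
    rw [hS, sq, hP, sum_mul_sum]
    refine sum_le_sum fun i _ => sum_le_sum fun j _ => ?_
    rw [← hB, mul_pow, mul_pow]
    exact mul_le_of_le_one_right (by positivity) (cos_sq_le_one _)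
  have hωN : ω * N ≤ S := by
    have : 0 ≤ ω * h * N := by positivity
    linarith
  have hNP : N ≤ h ^ 6 * P ^ 2 := by
    calc N = h ^ 6 * (ω * N) := by linear_combination -N * hh6
      _ ≤ _ := by gcongr; linarith
  have hO : ∑ i, ∑ j, (if cos (θ i - θ j) < 0 then r i ^ 2 * (r j ^ 2 * cos (θ i - θ j) ^ 2) else 0)
      ≤ h ^ 6 * P ^ 2 := by
    refine le_trans (sum_le_sum fun i _ => sum_le_sum fun j _ => ?_) (hNneg.trans hNP)
    split_ifs with hc
    · rw [← hB, min_eq_left]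
      · exact le_of_eq (by ring)
      · exact mul_nonpos_of_nonneg_of_nonpos (by positivity) hc.le
    · positivity
  have h2 := G.sum_sq_gram_sub_le h0 h50 hO
  simp only [hB] at h2
  rw [← hS, ← hP, ← hωdef] at h2
  have h3 : S * (1 - 25 * h) ≤ ω * N := by
    have h4 := mul_le_mul_of_nonneg_left hNn hω0.le
    have h5 := mul_le_mul_of_nonneg_left hPS h0.le
    linarith
  -- `(1 - 25 * h) * (1 + 50 * h) ≥ 1` exactly because `h ≤ 1 / 50`.
  have h6 : S ≤ S * (1 - 25 * h) * (1 + 50 * h) := by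
    have : 0 ≤ S * (h * (1 - 50 * h)) := mul_nonneg hS0 (mul_nonneg h0.le (by linarith))
    linarith
  have h7 := mul_le_mul_of_nonneg_right h3 (by positivity : 0 ≤ 1 + 50 * h)
  linarith

end SimpleGraph

/-! ### From the mismatch bound to eigenvalues. -/

namespace SimpleGraph

open Finset

variable {V : Type*} [Fintype V] (G : SimpleGraph V) [DecidableRel G.Adj]

/-- A bound for two orthonormal eigenvectors of the adjacency matrix with non-negative
eigenvalues. -/
theorem add_sq_le_of_orthonormal_eigenvectors [Nonempty V] {x y : V → ℝ} {l m : ℝ}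
    (hl : 0 ≤ l) (hm : 0 ≤ m) (hxx : ∑ i, x i ^ 2 = 1) (hyy : ∑ i, y i ^ 2 = 1)
    (hxy : ∑ i, x i * y i = 0) (hx : (G.adjMatrix ℝ).mulVec x = l • x)
    (hy : (G.adjMatrix ℝ).mulVec y = m • y) :
    l ^ 2 + m ^ 2 ≤ (1 - 1 / ((G.cliqueNum : ℝ) + 50 * (G.cliqueNum : ℝ) ^ ((5 : ℝ) / 6))) *
      (2 * (G.edgeFinset.card : ℝ)) := by
  set W : ℝ := (G.cliqueNum : ℝ) + 50 * (G.cliqueNum : ℝ) ^ ((5 : ℝ) / 6) with hW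
  have hω : (1 : ℝ) ≤ G.cliqueNum := by exact_mod_cast G.one_le_cliqueNum
  have hW1 : 1 ≤ W := by
    have : 0 ≤ (G.cliqueNum : ℝ) ^ ((5 : ℝ) / 6) := by positivity
    linarith
  set a : V → ℝ := fun i => √l * x i with ha
  set b : V → ℝ := fun i => √m * y i with hb
  set B : V → V → ℝ := fun i j => a i * a j + b i * b j with hB
  have hBe : ∀ i j, B i j = l * (x i * x j) + m * (y i * y j) := fun i j => by
    simp only [hB, ha, hb]
    linear_combination (x i * x j) * Real.mul_self_sqrt hl + (y i * y j) * Real.mul_self_sqrt hm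
  have hSB : ∑ i, ∑ j, B i j ^ 2 = l ^ 2 + m ^ 2 := by
    simp only [hB]
    rw [sum_sum_sq_mul_add_mul]
    have e1 : ∑ i, a i ^ 2 = l := by
      simp only [ha, mul_pow, Real.sq_sqrt hl]
      rw [← mul_sum, hxx, mul_one]
    have e2 : ∑ i, b i ^ 2 = m := by
      simp only [hb, mul_pow, Real.sq_sqrt hm]
      rw [← mul_sum, hyy, mul_one]
    have e3 : ∑ i, a i * b i = 0 := by
      calc ∑ i, a i * b i = √l * √m * ∑ i, x i * y i := by
            rw [mul_sum]; exact sum_congr rfl fun i _ => by simp only [ha, hb]; ring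
        _ = 0 := by rw [hxy, mul_zero]
    rw [e1, e2, e3]; ring
  have hquad : ∀ (v : V → ℝ) (c : ℝ), ∑ i, v i ^ 2 = 1 → (G.adjMatrix ℝ).mulVec v = c • v →
      ∑ i, ∑ j, (if G.Adj i j then v i * v j else 0) = c := by
    intro v c hv hc
    calc _ = ∑ i, v i * (G.adjMatrix ℝ).mulVec v i := by
          refine sum_congr rfl fun i _ => ?_
          rw [Matrix.mulVec, dotProduct, mul_sum]
          exact sum_congr rfl fun j _ => by rw [adjMatrix_apply]; split_ifs <;> simp
      _ = ∑ i, c * v i ^ 2 := sum_congr rfl fun i _ => by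
          rw [hc, Pi.smul_apply, smul_eq_mul]; ring
      _ = c := by rw [← mul_sum, hv, mul_one]
  have hAB : ∑ i, ∑ j, (if G.Adj i j then B i j else 0) = l ^ 2 + m ^ 2 := by
    calc _ = l * ∑ i, ∑ j, (if G.Adj i j then x i * x j else 0) +
          m * ∑ i, ∑ j, (if G.Adj i j then y i * y j else 0) := by
          simp only [mul_sum, ← sum_add_distrib]
          exact sum_congr rfl fun i _ => sum_congr rfl fun j _ => by
            rw [hBe]; split_ifs <;> simp
      _ = _ := by rw [hquad x l hxx hx, hquad y m hyy hy]; ring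
  have hedges : ∑ i, ∑ j, (if G.Adj i j then (1 : ℝ) else 0) = 2 * (G.edgeFinset.card : ℝ) := by
    have := G.sum_degrees_eq_twice_card_edges
    rw [← Nat.cast_two, ← Nat.cast_mul, ← this, Nat.cast_sum]
    refine sum_congr rfl fun i _ => ?_
    rw [← card_neighborFinset_eq_degree, neighborFinset_eq_filter, card_filter]
    simp
  set N := ∑ i, ∑ j, if G.Adj i j then min (B i j) 0 ^ 2 else B i j ^ 2 with hN
  have hmain : l ^ 2 + m ^ 2 ≤ W * N := by
    rw [← hSB]; exact G.sum_sq_gram_le_mul_mismatch a b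
  have hpos : ∑ i, ∑ j, (if G.Adj i j then max (B i j) 0 ^ 2 else 0) = l ^ 2 + m ^ 2 - N := by
    rw [← hSB, hN]
    simp only [← sum_sub_distrib]
    refine sum_congr rfl fun i _ => sum_congr rfl fun j _ => ?_
    split_ifs
    · rcases le_total (B i j) 0 with h | h
      · rw [max_eq_right h, min_eq_left h]; ring
      · rw [max_eq_left h, min_eq_right h]; ring
    · ring
  -- Replacing `B` by its positive part on edges only increases the pairing with the adjacency
  -- matrix, and leaves squared norm `s - N` for Cauchy–Schwarz.
  have hCS : (l ^ 2 + m ^ 2) ^ 2 ≤ 2 * (G.edgeFinset.card : ℝ) * (l ^ 2 + m ^ 2 - N) := by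
    have h1 : l ^ 2 + m ^ 2 ≤ ∑ i, ∑ j, (if G.Adj i j then max (B i j) 0 else 0) := by
      rw [← hAB]
      refine sum_le_sum fun i _ => sum_le_sum fun j _ => ?_
      split_ifs
      · exact le_max_left _ _
      · exact le_rfl
    refine (pow_le_pow_left₀ (by positivity) h1 2).trans ?_
    rw [← hedges, ← hpos]
    simp only [← Fintype.sum_prod_type' (f := fun i j => if G.Adj i j then max (B i j) 0 else 0),
      ← Fintype.sum_prod_type' (f := fun i j => if G.Adj i j then (1 : ℝ) else 0),
      ← Fintype.sum_prod_type' (f := fun i j => if G.Adj i j then max (B i j) 0 ^ 2 else 0)]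
    refine le_trans (le_of_eq ?_) ((sum_mul_sq_le_sq_mul_sq univ
      (fun p : V × V => if G.Adj p.1 p.2 then (1 : ℝ) else 0)
      (fun p : V × V => if G.Adj p.1 p.2 then max (B p.1 p.2) 0 else 0)).trans (le_of_eq ?_))
    · congr 1; exact sum_congr rfl fun p _ => by split_ifs <;> simp
    · congr 1 <;> exact sum_congr rfl fun p _ => by split_ifs <;> simp
  set s := l ^ 2 + m ^ 2 with hs
  set M : ℝ := 2 * (G.edgeFinset.card : ℝ) with hM
  have hM0 : 0 ≤ M := by positivity
  have hs0 : 0 ≤ s := by positivity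
  have hW0 : 0 < W := by linarith
  have hinv : 1 / W ≤ 1 := by rw [div_le_one hW0]; exact hW1
  rcases hs0.eq_or_lt with h0 | h0
  · rw [← h0]; exact mul_nonneg (by linarith) hM0
  · have h1 : s * (1 / W) ≤ N := by
      rw [mul_one_div, div_le_iff₀ hW0]; linarith
    refine le_of_mul_le_mul_right ?_ h0
    have h2 := mul_le_mul_of_nonneg_left h1 hM0
    calc s * s ≤ M * (s - N) := by rw [← sq]; exact hCS
      _ ≤ (1 - 1 / W) * M * s := by linarith

end SimpleGraph

/-! ### Non-negativity of the second eigenvalue. -/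

open Finset in
/-- If a non-zero vector orthogonal to the first vector of the eigenbasis has non-negative
Rayleigh quotient, the second largest eigenvalue is non-negative. -/
theorem LinearMap.IsSymmetric.eigenvalues_one_nonneg {E : Type*} [NormedAddCommGroup E]
    [InnerProductSpace ℝ E] [FiniteDimensional ℝ E] {T : E →ₗ[ℝ] E} (hT : T.IsSymmetric) {n : ℕ}
    (hn : Module.finrank ℝ E = n) (h0 : 0 < n) (h1 : 1 < n) {z : E} (hz : z ≠ 0)
    (horth : inner ℝ (hT.eigenvectorBasis hn ⟨0, h0⟩) z = 0) (hnn : 0 ≤ inner ℝ z (T z)) :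
    0 ≤ hT.eigenvalues hn ⟨1, h1⟩ := by
  by_contra! hneg
  set b := hT.eigenvectorBasis hn
  have hsum : inner ℝ z (T z) = ∑ i, hT.eigenvalues hn i * inner ℝ (b i) z ^ 2 := by
    rw [← b.sum_inner_mul_inner]
    refine sum_congr rfl fun i _ => ?_
    rw [← hT, hT.apply_eigenvectorBasis, real_inner_comm, inner_smul_left]
    simp only [b]
    simp
    ring
  have hneg' : ∀ i : Fin n, i ≠ ⟨0, h0⟩ → hT.eigenvalues hn i < 0 := fun i hi =>
    lt_of_le_of_lt (hT.eigenvalues_antitone hn (by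
      rw [Fin.le_def]
      have : (i : ℕ) ≠ 0 := fun h => hi (Fin.ext h)
      simp; omega)) hneg
  have hterm : ∀ i, hT.eigenvalues hn i * inner ℝ (b i) z ^ 2 ≤ 0 := fun i => by
    by_cases hi : i = ⟨0, h0⟩
    · rw [hi, horth]; simp
    · exact mul_nonpos_of_nonpos_of_nonneg (hneg' i hi).le (sq_nonneg _)
  -- A non-negative sum of non-positive terms: each vanishes, so all coordinates of `z` do.
  have hzero := (sum_eq_zero_iff_of_nonpos fun i _ => hterm i).mp
    (le_antisymm (sum_nonpos fun i _ => hterm i) (hsum ▸ hnn))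
  refine hz (b.repr.injective (PiLp.ext fun i => ?_))
  rw [b.repr_apply_apply, map_zero, PiLp.zero_apply]
  by_cases hi : i = ⟨0, h0⟩
  · rw [hi, horth]
  · have := hzero i (mem_univ i)
    exact pow_eq_zero_iff two_ne_zero |>.mp
      ((mul_eq_zero.mp this).resolve_left (hneg' i hi).ne)

namespace SimpleGraph

open Finset

/-- The second largest adjacency eigenvalue of a graph that is not complete is non-negative. -/
theorem adjEigenvalue_one_nonneg {V : Type*} [Fintype V] [DecidableEq V] (G : SimpleGraph V)
    [DecidableRel G.Adj] (hG : G ≠ ⊤) : 0 ≤ G.adjEigenvalue ⟨1, one_lt_card_of_ne_top hG⟩ := by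
  obtain ⟨u, v, huv, hadj⟩ := ne_top_iff_exists_not_adj.mp hG
  set hT := Matrix.isSymmetric_toEuclideanLin_iff.mpr (G.isHermitian_adjMatrix ℝ)
  set x := hT.eigenvectorBasis finrank_euclideanSpace
    ⟨0, zero_lt_one.trans (one_lt_card_of_ne_top hG)⟩
  -- A combination of two non-adjacent vertices can be made orthogonal to the top eigenvector; its
  -- quadratic form is zero, as its support spans no edge.
  obtain ⟨α, β, hαβ, hx⟩ : ∃ α β : ℝ, (α ≠ 0 ∨ β ≠ 0) ∧ α * x u + β * x v = 0 := by
    by_cases h : x u = 0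
    · exact ⟨1, 0, by simp, by simp [h]⟩
    · exact ⟨x v, -x u, by simp [h], by ring⟩
  set z : EuclideanSpace ℝ V := WithLp.toLp 2 (fun i => if i = u then α else if i = v then β else 0)
    with hz
  have hzi : ∀ i, z i = if i = u then α else if i = v then β else 0 := fun i => rfl
  refine hT.eigenvalues_one_nonneg finrank_euclideanSpace
    (zero_lt_one.trans (one_lt_card_of_ne_top hG)) (one_lt_card_of_ne_top hG) (z := z) ?_ ?_ ?_
  · intro h
    have hu : z u = 0 := by rw [h]; rfl
    have hv : z v = 0 := by rw [h]; rfl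
    rw [hzi] at hu hv
    simp [huv.symm] at hu hv
    tauto
  · rw [PiLp.inner_apply]
    have : ∀ i, inner ℝ (x i) (z i) =
        (if i = u then α * x u else 0) + (if i = v then β * x v else 0) := fun i => by
      rw [hzi]
      by_cases h1 : i = u
      · subst h1; simp [huv]
      · by_cases h2 : i = v
        · subst h2; simp [h1]
        · simp [h1, h2]
    simp only [x] at this hx ⊢
    rw [sum_congr rfl fun i _ => this i, sum_add_distrib]
    simpa using hx
  · refine le_of_eq (Eq.symm ?_)
    rw [PiLp.inner_apply]
    refine sum_eq_zero fun i _ => ?_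
    have e : Matrix.toEuclideanLin (G.adjMatrix ℝ) z i = ∑ j, G.adjMatrix ℝ i j * z j := rfl
    have hvu : ¬ G.Adj v u := fun h => hadj h.symm
    rw [e, hzi]
    by_cases h1 : i = u
    · subst h1
      rw [sum_eq_zero]
      · simp
      · intro j _
        rw [hzi, adjMatrix_apply]
        by_cases h2 : j = i
        · simp [h2]
        · by_cases h3 : j = v
          · simp [h3, hadj]
          · simp [h2, h3]
    · by_cases h1' : i = v
      · subst h1'
        rw [sum_eq_zero]
        · simp
        · intro j _
          rw [hzi, adjMatrix_apply]
          by_cases h2 : j = i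
          · simp [h2]
          · by_cases h3 : j = u
            · simp [h3, hvu]
            · simp [h2, h3]
      · simp [h1, h1']

end SimpleGraph

theorem theorem3 {V : Type*} [Fintype V] [DecidableEq V] (G : SimpleGraph V)
    [DecidableRel G.Adj] (hG : G ≠ ⊤) :
    G.adjEigenvalue ⟨0, zero_lt_one.trans (SimpleGraph.one_lt_card_of_ne_top hG)⟩ ^ 2 +
        G.adjEigenvalue ⟨1, SimpleGraph.one_lt_card_of_ne_top hG⟩ ^ 2 ≤
      (1 - 1 / ((G.cliqueNum : ℝ) + 50 * (G.cliqueNum : ℝ) ^ ((5 : ℝ) / 6))) *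
        (2 * (G.edgeFinset.card : ℝ)) := by
  have hcard := SimpleGraph.one_lt_card_of_ne_top hG
  have : Nonempty V := Fintype.card_pos_iff.mp (zero_lt_one.trans hcard)
  -- Non-negativity is what allows the square roots of the eigenvalues in the planar Gram
  -- representation.
  have h1 := G.adjEigenvalue_one_nonneg hG
  have h0 : 0 ≤ G.adjEigenvalue ⟨0, zero_lt_one.trans hcard⟩ :=
    h1.trans ((G.isHermitian_adjMatrix ℝ).eigenvalues₀_antitone (by simp))
  have hT := Matrix.isSymmetric_toEuclideanLin_iff.mpr (G.isHermitian_adjMatrix ℝ)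
  set b := hT.eigenvectorBasis finrank_euclideanSpace with hb
  have hnorm : ∀ i, ∑ k, b i k ^ 2 = 1 := fun i => by
    rw [← EuclideanSpace.real_norm_sq_eq, b.norm_eq_one, one_pow]
  have hmul : ∀ i, (G.adjMatrix ℝ).mulVec (b i) = G.adjEigenvalue i • (b i : V → ℝ) := fun i => by
    have := hT.apply_eigenvectorBasis finrank_euclideanSpace i
    exact congrArg (fun w : EuclideanSpace ℝ V => (w : V → ℝ)) this
  refine G.add_sq_le_of_orthonormal_eigenvectors h0 h1 (hnorm _) (hnorm _) ?_ (hmul _) (hmul _)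
  have := b.inner_eq_zero (i := ⟨1, hcard⟩) (j := ⟨0, zero_lt_one.trans hcard⟩) (by simp)
  rw [PiLp.inner_apply] at this
  simpa using this
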